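/- **The algorithm.** Let $\mathcal G=(V,\mathcal E)$ be a finite directed graph without self-loops, $|V|=N$, and let $p,q\in(0,1)$. For $u\in V$ let $\mathcal N^-_u=\{v\in V:(v,u)\in\mathcal E\}$ be the set of in-neighbors of $u$. The Collision Broadcast Gossip Algorithm (CBGA) with parameters $p,q$ started at $x(0)\in\mathbb R^V$ is the following process $x(t)\in\mathbb R^V$, $t=0,1,2,\dots$. At each time $t$ every node wakes up with probability $p$, independently over all nodes and times; let $\mathrm{Act}(t)$ be the set of the nodes that wake up. Let $\mathrm{Rec}(t)$ be the set of all $u\in V\setminus\mathrm{Act}(t)$ with $|\mathcal N^-_u\cap\mathrm{Act}(t)|=1$, and for $u\in\mathrm{Rec}(t)$ let $\sigma_t(u)$ be the only element of $\mathcal N^-_u\cap\mathrm{Act}(t)$. Then $$x_u(t+1)=\begin{cases}(1-q)\,x_u(t)+q\,x_{\sigma_t(u)}(t) & \text{if } u\in\mathrm{Rec}(t),\\ x_u(t) & \text{otherwise.}\end{cases}$$ Let $x_{\mathrm{ave}}(t)=N^{-1}\sum_{v\in V}x_v(t)$ and $\beta(t)=|x_{\mathrm{ave}}(t)-x_{\mathrm{ave}}(0)|^2$.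 A bias matrix of the CBGA on $\mathcal G$ is a matrix $B\in\mathbb R^{V\times V}$ such that $\lim_{t\to\infty}\mathbb E[\beta(t)]=x(0)^{*}B\,x(0)$ for every $x(0)\in\mathbb R^V$. All bias matrices have the same trace, because they define the same quadratic form. **Theorem (Unbiasedness of CBGA).** Fix $p,q\in(0,1)$ and a finite set $S\subseteq\mathbb Z^d\setminus\{0\}$ that generates $\mathbb Z^d$ as a group. For every integer $n\ge 0$ let $V_n=[-n,n]^d$, considered as the Abelian group $\mathbb Z_{2n+1}^d$, and let $\mathcal G^{(n)}$ be the Abelian Cayley graph on $V_n$ generated by $S_n=S\cap[-n,n]^d$, that is, the directed graph with an edge from $g$ to $h$ if and only if $h-g\in S_n$. Then for every $n$ the CBGA on $\mathcal G^{(n)}$ has a bias matrix $B_n$, and the CBGA is asymptotically unbiased on the sequence $\mathcal G^{(n)}$: $$\lim_{n\to\infty}\operatorname{tr}(B_n)=0 .$$ -/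

import Mathlib

open MeasureTheory ProbabilityTheory Filter Topology

namespace CBGA

/-! ### One step of the algorithm on a directed graph

`G.Adj v u` means that there is an edge from `v` to `u`: then `v` is an in-neighbor of `u`, and
what `v` broadcasts is sent to `u`. -/

section Step

variable {V : Type*} [Fintype V]

open Classical in
/-- The in-neighbors of `u`. -/
noncomputable def inNeighbors (G : Digraph V) (u : V) : Finset V :=
  Finset.univ.filter fun v => G.Adj v u

open Classical in
/-- The nodes that receive a message when `act` is the set of broadcasting nodes: those that are
silent (half-duplex) and have exactly one broadcasting in-neighbor (no collision). -/
noncomputable def receivers (G : Digraph V) (act : Finset V) : Finset V :=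
  Finset.univ.filter fun u => (inNeighbors G u ∩ act).card = 1 ∧ u ∉ act

open Classical in
theorem exists_sender (G : Digraph V) (act : Finset V) (u : V) (hu : u ∈ receivers G act) :
    ∃ v, inNeighbors G u ∩ act = {v} :=
  Finset.card_eq_one.mp (Finset.mem_filter.mp hu).2.1

/-- The only broadcasting in-neighbor of a receiving node. -/
noncomputable def sender (G : Digraph V) (act : Finset V) (u : V) (hu : u ∈ receivers G act) : V :=
  (exists_sender G act u hu).choose

open Classical in
theorem sender_spec (G : Digraph V) (act : Finset V) (u : V) (hu : u ∈ receivers G act) :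
    inNeighbors G u ∩ act = {sender G act u hu} :=
  (exists_sender G act u hu).choose_spec

open Classical in
/-- One step of the Collision Broadcast Gossip Algorithm with weight `q`, when `act` is the set of
broadcasting nodes. -/
noncomputable def update (G : Digraph V) (q : ℝ) (act : Finset V) (x : V → ℝ) : V → ℝ :=
  fun u => if hu : u ∈ receivers G act then (1 - q) * x u + q * x (sender G act u hu) else x u

/-- The average of the values at the nodes. -/
noncomputable def average (x : V → ℝ) : ℝ := (∑ v, x v) / Fintype.card V

end Step

/-! ### The random process and its bias -/

section Dynamics

variable {V : Type*} [Fintype V] {Ω : Type*}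

/-- `awake t v` is the event that the node `v` wakes up at time `t`. All these events, over all
times and all nodes, are independent and have probability `p`. -/
structure IsActivation [MeasurableSpace Ω] (μ : Measure Ω) (p : ℝ) (awake : ℕ → V → Set Ω) : Prop where
  measurableSet : ∀ t v, MeasurableSet (awake t v)
  prob : ∀ t v, μ (awake t v) = ENNReal.ofReal p
  indep : iIndepSet (fun tv : ℕ × V => awake tv.1 tv.2) μ

open Classical in
/-- The random set of the nodes that broadcast at time `t`. -/
noncomputable def active (awake : ℕ → V → Set Ω) (t : ℕ) (ω : Ω) : Finset V :=
  Finset.univ.filter fun v => ω ∈ awake t v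

/-- The state `x(t)` of the Collision Broadcast Gossip Algorithm started at `x₀`. -/
noncomputable def state (G : Digraph V) (q : ℝ) (awake : ℕ → V → Set Ω) (x₀ : V → ℝ) :
    ℕ → Ω → V → ℝ
  | 0, _ => x₀
  | t + 1, ω => update G q (active awake t ω) (state G q awake x₀ t ω)

/-- The squared displacement of the average at time `t` from the initial average. -/
noncomputable def beta (G : Digraph V) (q : ℝ) (awake : ℕ → V → Set Ω) (x₀ : V → ℝ)
    (t : ℕ) (ω : Ω) : ℝ :=
  |average (state G q awake x₀ t ω) - average x₀| ^ 2

/-- `B` is a bias matrix of the algorithm: for every initial state `x₀`, the expected squared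
displacement of the average converges to `x₀ᵀ B x₀`. (For each `t` the random variable `beta` is
measurable and takes finitely many values; integrability is recorded nevertheless.) -/
def IsBiasMatrix [MeasurableSpace Ω] (μ : Measure Ω) (G : Digraph V) (q : ℝ) (awake : ℕ → V → Set Ω)
    (B : Matrix V V ℝ) : Prop :=
  ∀ x₀ : V → ℝ,
    (∀ t, Integrable (beta G q awake x₀ t) μ) ∧
      Tendsto (fun t => ∫ ω, beta G q awake x₀ t ω ∂μ) atTop (𝓝 (x₀ ⬝ᵥ (B.mulVec x₀)))

end Dynamics

/-! ### Abelian Cayley graphs -/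

/-- The Abelian Cayley graph generated by `S` in `A`: there is an edge from `g` to `h` when
`h - g ∈ S`. -/
def cayleyDigraph {A : Type*} [AddCommGroup A] (S : Set A) : Digraph A where
  Adj g h := h - g ∈ S

/-- The group `(ℤ / (2n+1))^d`; its elements are represented by the integer points of the cube
`[-n, n]^d`. -/
abbrev Torus (d n : ℕ) : Type := Fin d → ZMod (2 * n + 1)

/-- The elements of `S ∩ [-n, n]^d`, considered in the group `(ℤ / (2n+1))^d`. -/
def torusGenerators {d : ℕ} (S : Finset (Fin d → ℤ)) (n : ℕ) : Set (Torus d n) :=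
  {g | ∃ s ∈ S, (∀ i, -(n : ℤ) ≤ s i ∧ s i ≤ n) ∧ g = fun i => (s i : ZMod (2 * n + 1))}

/-- The Abelian Cayley graph on `(ℤ / (2n+1))^d` generated by `S ∩ [-n, n]^d`. -/
def torusGraph {d : ℕ} (S : Finset (Fin d → ℤ)) (n : ℕ) : Digraph (Torus d n) :=
  cayleyDigraph (torusGenerators S n)

end CBGA

/-! On a Cayley graph the offset from a node to the node it listens to has the same law everywhere,
so a step preserves the average in expectation (`preservesAverage_cayleyDigraph`). The squared
average is then nondecreasing in expectation and bounded; hence E[beta(t)] converges, and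
polarization yields a bias matrix (`IsActivation.exists_isBiasMatrix`).

Second moments evolve under `pairStep`, a Markov operator: two dual walkers move to their sources,
each with its own `q`-coin but driven by the same broadcasts. Summing over the initial states e_v
bounds the trace by the long-run fraction of time that the pair, started uniformly, spends on the
diagonal (`IsBiasMatrix.trace_le`).

That fraction is controlled by a Lyapunov function F: with L = 2n+1, the parabola z(L-z)/L of one
coordinate z of the difference. The walkers have equal mean displacements, so the drift cancels and
a step lowers F on average by at most the curvature term ε = (2R)²/L (`lyapunov_sub_le_pairStep`).
On the diagonal F vanishes, and a step raises it on average by at least a δ > 0 independent of n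
(`le_pairStep_lyapunov_self`). As F is bounded, the fraction is at most ε/δ = O(1/n). -/

namespace CBGA

/-! ### The law of the set of broadcasting nodes -/

section Weight

variable {V : Type*} [Fintype V]

open Classical in
theorem sum_finset_prod_ite (f g : V → ℝ) :
    ∑ s : Finset V, ∏ v, (if v ∈ s then f v else g v) = ∏ v, (f v + g v) := by
  rw [Finset.prod_add, Finset.powerset_univ]
  refine Finset.sum_congr rfl fun s _ => ?_
  rw [Finset.prod_ite]
  congr 1
  · exact Finset.prod_congr (by ext; simp) fun _ _ => rfl
  · exact Finset.prod_congr (by ext; simp) fun _ _ => rfl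

open Classical in
/-- The probability that exactly the nodes in `act` wake up. -/
noncomputable def weight (p : ℝ) (act : Finset V) : ℝ := ∏ v, if v ∈ act then p else 1 - p

theorem sum_weight (p : ℝ) : ∑ act : Finset V, weight p act = 1 := by
  classical
  simp only [weight]
  rw [sum_finset_prod_ite]
  simp

theorem weight_nonneg {p : ℝ} (h0 : 0 ≤ p) (h1 : p ≤ 1) (act : Finset V) : 0 ≤ weight p act := by
  refine Finset.prod_nonneg fun v _ => ?_
  split_ifs <;> linarith

theorem weight_map (p : ℝ) (e : V ≃ V) (act : Finset V) :
    weight p (act.map e.toEmbedding) = weight p act := by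
  classical
  simp only [weight]
  rw [← Equiv.prod_comp e]
  simp

theorem sum_weight_map (p : ℝ) (e : V ≃ V) (f : Finset V → ℝ) :
    ∑ act, weight p act * f (act.map e.toEmbedding) = ∑ act, weight p act * f act := by
  rw [← Equiv.sum_comp e.finsetCongr fun act => weight p act * f act]
  simp only [Equiv.finsetCongr_apply, weight_map]

open Classical in
-- The indicator factors over nodes. Expanding gives one factor per node: `p` at `v`, `1 - p` on
-- `K`, and `1` elsewhere.
theorem sum_weight_filter (p : ℝ) (v : V) (K : Finset V) (hv : v ∉ K) :
    ∑ act : Finset V, weight p act * (if v ∈ act ∧ Disjoint K act then 1 else 0) =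
      p * (1 - p) ^ K.card := by
  have key : ∀ act : Finset V, weight p act * (if v ∈ act ∧ Disjoint K act then 1 else 0) =
      ∏ x, (if x ∈ act then (if x ∈ K then 0 else p) else (if x = v then 0 else 1 - p)) := by
    intro act
    split_ifs with h
    · rw [mul_one]
      refine Finset.prod_congr rfl fun x _ => ?_
      by_cases hx : x ∈ act
      · simp [hx, Finset.disjoint_right.mp h.2 hx]
      · have : x ≠ v := fun e => hx (e ▸ h.1)
        simp [hx, this]
    · rw [mul_zero, eq_comm]
      by_cases hva : v ∈ act
      · obtain ⟨x, hxK, hxa⟩ := Finset.not_disjoint_iff.mp fun hd => h ⟨hva, hd⟩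
        exact Finset.prod_eq_zero (Finset.mem_univ x) (by simp [hxK, hxa])
      · exact Finset.prod_eq_zero (Finset.mem_univ v) (by simp [hva])
  simp only [key]
  rw [sum_finset_prod_ite]
  have : ∀ x, ((if x ∈ K then 0 else p) + (if x = v then 0 else 1 - p)) =
      (if x = v then p else 1) * (if x ∈ K then 1 - p else 1) := by
    intro x
    by_cases hx : x = v
    · subst hx; simp [hv]
    · by_cases hK : x ∈ K <;> simp [hx, hK]
  simp only [this]
  rw [Finset.prod_mul_distrib, Finset.prod_ite_eq' Finset.univ v, Finset.prod_ite_mem]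
  simp

end Weight

/-! ### The source of a message -/

section Source

variable {V : Type*} [Fintype V]

open Classical in
/-- The node whose value `u` mixes into its own: the sender if `u` receives a message, and `u`
itself otherwise. -/
noncomputable def source (G : Digraph V) (act : Finset V) (u : V) : V :=
  if hu : u ∈ receivers G act then sender G act u hu else u

/-- A node that receives nothing listens to itself, which merges both cases into one linear formula.
-/
theorem update_apply (G : Digraph V) (q : ℝ) (act : Finset V) (x : V → ℝ) (u : V) :
    update G q act x u = (1 - q) * x u + q * x (source G act u) := by
  unfold update source
  split_ifs <;> ring

open Classical in
theorem source_eq_of_inter_eq {G : Digraph V} {act : Finset V} {u v : V} (hu : u ∉ act)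
    (h : inNeighbors G u ∩ act = {v}) : source G act u = v := by
  have hr : u ∈ receivers G act := by simp [receivers, h, hu]
  rw [source, dif_pos hr]
  exact (Finset.singleton_injective ((sender_spec G act u hr).symm.trans h))

theorem source_eq_of_forall_iff {G : Digraph V} {act : Finset V} {u v : V} (hu : u ∉ act)
    (h : ∀ x, x ∈ inNeighbors G u ∧ x ∈ act ↔ x = v) : source G act u = v := by
  classical
  refine source_eq_of_inter_eq hu (Finset.ext fun x => ?_)
  rw [Finset.mem_inter, Finset.mem_singleton, h]

open Classical in
theorem source_cases (G : Digraph V) (act : Finset V) (u : V) :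
    (u ∉ act ∧ inNeighbors G u ∩ act = {source G act u}) ∨
      (u ∉ receivers G act ∧ source G act u = u) := by
  by_cases hr : u ∈ receivers G act
  · left
    rw [source, dif_pos hr]
    exact ⟨(Finset.mem_filter.mp hr).2.2, sender_spec G act u hr⟩
  · right
    exact ⟨hr, dif_neg hr⟩

theorem source_eq_or_adj (G : Digraph V) (act : Finset V) (u : V) :
    source G act u = u ∨ G.Adj (source G act u) u := by
  classical
  rcases source_cases G act u with ⟨-, h⟩ | ⟨-, h⟩
  · right
    have : source G act u ∈ inNeighbors G u ∩ act := h ▸ Finset.mem_singleton_self _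
    exact (Finset.mem_filter.mp (Finset.mem_inter.mp this).1).2
  · exact Or.inl h

theorem source_map (G : Digraph V) (e : V ≃ V) (he : ∀ a b, G.Adj (e a) (e b) ↔ G.Adj a b)
    (act : Finset V) (u : V) : source G (act.map e.toEmbedding) (e u) = e (source G act u) := by
  classical
  have hI : inNeighbors G (e u) ∩ act.map e.toEmbedding =
      (inNeighbors G u ∩ act).map e.toEmbedding := by
    ext w
    obtain ⟨w, rfl⟩ := e.surjective w
    simp [inNeighbors, he]
  rcases source_cases G act u with ⟨h1, h2⟩ | ⟨h1, h2⟩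
  · refine source_eq_of_inter_eq (by simpa using h1) ?_
    rw [hI, h2]
    simp
  · rw [h2, source, dif_neg]
    intro h
    apply h1
    simpa [receivers, hI] using h

theorem update_add (G : Digraph V) (q : ℝ) (act : Finset V) (x y : V → ℝ) :
    update G q act (x + y) = update G q act x + update G q act y := by
  ext u; simp only [update_apply, Pi.add_apply]; ring

theorem update_smul (G : Digraph V) (q : ℝ) (act : Finset V) (c : ℝ) (x : V → ℝ) :
    update G q act (c • x) = c • update G q act x := by
  ext u; simp only [update_apply, Pi.smul_apply, smul_eq_mul]; ring

/-- The state as a linear function of the initial state. -/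
noncomputable def stateMap {Ω : Type*} (G : Digraph V) (q : ℝ) (awake : ℕ → V → Set Ω) (t : ℕ)
    (ω : Ω) : (V → ℝ) →ₗ[ℝ] (V → ℝ) where
  toFun x := state G q awake x t ω
  map_add' x y := by
    induction t with
    | zero => rfl
    | succ t ih => simp only [state, ih, update_add]
  map_smul' c x := by
    induction t with
    | zero => rfl
    | succ t ih => simp only [state, ih, update_smul, RingHom.id_apply]

theorem abs_state_le {Ω : Type*} (G : Digraph V) {q : ℝ} (hq0 : 0 ≤ q) (hq1 : q ≤ 1)
    (awake : ℕ → V → Set Ω) {x : V → ℝ} {C : ℝ} (hx : ∀ u, |x u| ≤ C) (t : ℕ) (ω : Ω) (u : V) :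
    |state G q awake x t ω u| ≤ C := by
  induction t generalizing u with
  | zero => exact hx u
  | succ t ih =>
    rw [state, update_apply]
    have h1 := abs_le.mp (ih u)
    have h2 := abs_le.mp (ih (source G (active awake t ω) u))
    rw [abs_le]
    constructor <;> nlinarith

theorem abs_average_le [Nonempty V] {x : V → ℝ} {C : ℝ} (hx : ∀ u, |x u| ≤ C) :
    |average x| ≤ C := by
  have hN : (0 : ℝ) < Fintype.card V := by exact_mod_cast Fintype.card_pos
  rw [average, abs_div, abs_of_pos hN, div_le_iff₀ hN]
  calc |∑ v, x v| ≤ ∑ v, |x v| := Finset.abs_sum_le_sum_abs _ _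
    _ ≤ ∑ _v : V, C := Finset.sum_le_sum fun v _ => hx v
    _ = C * Fintype.card V := by simp [mul_comm]

end Source

/-! ### Space-time windows -/

section Window

variable {V : Type*} {Ω : Type*}

/-- What happened in the space-time window `W`. -/
def window (awake : ℕ → V → Set Ω) (W : Finset (ℕ × V)) (ω : Ω) (i : W) : Prop :=
  ω ∈ awake i.1.1 i.1.2

/-- The wake-up events as functions of a space-time window. -/
def windowAwake (W : Finset (ℕ × V)) (t : ℕ) (v : V) : Set (W → Prop) :=
  {η | ∃ h : (t, v) ∈ W, η ⟨(t, v), h⟩}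

variable [MeasurableSpace Ω] {μ : Measure Ω} {p : ℝ} {awake : ℕ → V → Set Ω}

theorem IsActivation.measurable_mem (h : IsActivation μ p awake) (i : ℕ × V) :
    Measurable fun ω => ω ∈ awake i.1 i.2 :=
  measurableSet_setOfPred.mp (h.measurableSet i.1 i.2)

theorem IsActivation.measurable_window (h : IsActivation μ p awake) (W : Finset (ℕ × V)) :
    Measurable (window awake W) :=
  measurable_pi_lambda _ fun i => h.measurable_mem i.1

theorem IsActivation.iIndepFun_mem (h : IsActivation μ p awake) :
    iIndepFun (fun (i : ℕ × V) ω => ω ∈ awake i.1 i.2) μ := by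
  have := (iIndepSet_iff_iIndep _ _).mp h.indep
  simp only [MeasurableSpace.generateFrom_singleton] at this
  exact this

theorem IsActivation.indepFun_window (h : IsActivation μ p awake) {W W' : Finset (ℕ × V)}
    (hW : Disjoint W W') : IndepFun (window awake W) (window awake W') μ :=
  h.iIndepFun_mem.indepFun_finset W W' hW h.measurable_mem

end Window

/-! ### Expectations one step ahead -/

section Dynamics

variable {V : Type*} [Fintype V] {Ω : Type*}

theorem state_congr {Ω' : Type*} (G : Digraph V) (q : ℝ) (awake : ℕ → V → Set Ω)
    (awake' : ℕ → V → Set Ω') (x : V → ℝ) {ω : Ω} {ω' : Ω'} {t : ℕ}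
    (h : ∀ s < t, active awake s ω = active awake' s ω') :
    state G q awake x t ω = state G q awake' x t ω' := by
  induction t with
  | zero => rfl
  | succ t ih => rw [state, state, h t (Nat.lt_succ_self t), ih fun s hs => h s (hs.trans t.lt_succ_self)]

theorem active_windowAwake (awake : ℕ → V → Set Ω) (W : Finset (ℕ × V)) {t : ℕ}
    (ht : ∀ v, (t, v) ∈ W) (ω : Ω) :
    active (windowAwake W) t (window awake W ω) = active awake t ω := by
  ext v
  classical
  refine Finset.mem_filter.trans (Iff.trans ?_ Finset.mem_filter.symm)
  exact and_congr_right fun _ => ⟨fun ⟨_, h⟩ => h, fun h => ⟨ht v, h⟩⟩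

/-- The past of time `t`. -/
def past (t : ℕ) : Finset (ℕ × V) := Finset.range t ×ˢ Finset.univ

/-- The time slice at `t`. -/
def slice (t : ℕ) : Finset (ℕ × V) := {t} ×ˢ Finset.univ

theorem disjoint_past_slice (t : ℕ) : Disjoint (past t : Finset (ℕ × V)) (slice t) := by
  refine Finset.disjoint_left.mpr fun a ha hb => ?_
  simp only [past, slice, Finset.mem_product, Finset.mem_range, Finset.mem_singleton] at ha hb
  omega

/-- The state factors through a finite window, whose configurations form a finite type.
Measurability and integrability become automatic, and independence reduces to disjointness of
windows. -/
theorem state_eq_window (G : Digraph V) (q : ℝ) (awake : ℕ → V → Set Ω) (x : V → ℝ) (t : ℕ)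
    (ω : Ω) :
    state G q awake x t ω = state G q (windowAwake (past t)) x t (window awake (past t) ω) :=
  state_congr G q _ _ x fun s hs => (active_windowAwake awake (past t)
    (fun v => by simp [past, hs]) ω).symm

variable [MeasurableSpace Ω] {μ : Measure Ω} {p : ℝ} {awake : ℕ → V → Set Ω}

theorem IsActivation.measurable_comp_state (h : IsActivation μ p awake) (G : Digraph V) (q : ℝ)
    (x : V → ℝ) (f : (V → ℝ) → ℝ) (t : ℕ) :
    Measurable fun ω => f (state G q awake x t ω) := by
  simp only [state_eq_window G q awake x t]
  exact (measurable_of_finite fun η => f (state G q (windowAwake (past t)) x t η)).comp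
    (h.measurable_window _)

theorem IsActivation.integrable_comp_state [IsProbabilityMeasure μ] (h : IsActivation μ p awake)
    (G : Digraph V) (q : ℝ) (x : V → ℝ) (f : (V → ℝ) → ℝ) (t : ℕ) :
    Integrable (fun ω => f (state G q awake x t ω)) μ := by
  simp only [state_eq_window G q awake x t]
  have := Measure.isProbabilityMeasure_map (μ := μ) (h.measurable_window (past t)).aemeasurable
  exact (Integrable.of_finite (μ := μ.map (window awake (past t)))
    (f := fun η => f (state G q (windowAwake (past t)) x t η))).comp_measurable
    (h.measurable_window _)

open Classical in
theorem IsActivation.integral_indicator_active [IsProbabilityMeasure μ]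
    (h : IsActivation μ p awake) (hp0 : 0 ≤ p) (t : ℕ) (act : Finset V) :
    ∫ ω, (if active awake t ω = act then (1 : ℝ) else 0) ∂μ = weight p act := by
  let f : ℕ × V → Set Ω := fun i => if i.2 ∈ act then awake i.1 i.2 else (awake i.1 i.2)ᶜ
  have hset : {ω | active awake t ω = act} = ⋂ i ∈ slice t, f i := by
    ext ω
    simp only [Set.mem_ofPred_eq, Set.mem_iInter, Finset.ext_iff, slice, Finset.mem_product,
      Finset.mem_singleton, Finset.mem_univ, and_true, Prod.forall, f, active, Finset.mem_filter,
      true_and]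
    constructor
    · rintro H s v rfl
      specialize H v
      split_ifs with hv
      · exact H.mpr hv
      · exact fun hω => hv (H.mp hω)
    · intro H v
      specialize H t v rfl
      split_ifs at H with hv
      · exact ⟨fun _ => hv, fun _ => H⟩
      · exact ⟨fun hω => (H hω).elim, fun h' => (hv h').elim⟩
  have hf : ∀ i, MeasurableSet (f i) := fun i => by
    simp only [f]; split_ifs
    exacts [h.measurableSet _ _, (h.measurableSet _ _).compl]
  have hμ : ∀ i, μ.real (f i) = if i.2 ∈ act then p else 1 - p := fun i => by
    have hr : μ.real (awake i.1 i.2) = p := by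
      rw [measureReal_def, h.prob, ENNReal.toReal_ofReal hp0]
    simp only [f]; split_ifs
    · exact hr
    · rw [probReal_compl_eq_one_sub (h.measurableSet _ _), hr]
  have hm : MeasurableSet {ω | active awake t ω = act} := by
    rw [hset]
    exact Finset.measurableSet_biInter _ fun i _ => hf i
  have : (fun ω => if active awake t ω = act then (1 : ℝ) else 0) =
      {ω | active awake t ω = act}.indicator 1 := by
    ext ω; simp [Set.indicator_apply]
  rw [this, integral_indicator_one hm, hset, measureReal_def,
    ((iIndepSet_iff_iIndep _ _).mp h.indep).meas_biInter fun i _ => ?_, ENNReal.toReal_prod]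
  · simp only [← measureReal_def, hμ]
    rw [slice, Finset.prod_product]
    simp [weight]
  · have := MeasurableSpace.measurableSet_generateFrom (Set.mem_singleton (awake i.1 i.2))
    simp only [f]; split_ifs
    exacts [this, this.compl]

/-- Markov property: the broadcast set at `t` is read off `slice t`, the state off `past t`, and
these are independent. -/
theorem IsActivation.integral_state_succ [IsProbabilityMeasure μ] (h : IsActivation μ p awake)
    (hp0 : 0 ≤ p) (G : Digraph V) (q : ℝ) (x : V → ℝ) (f : (V → ℝ) → ℝ) (t : ℕ) :
    ∫ ω, f (state G q awake x (t + 1) ω) ∂μ =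
      ∑ act, weight p act * ∫ ω, f (update G q act (state G q awake x t ω)) ∂μ := by
  classical
  have hX : ∀ act, Measurable fun ω => if active awake t ω = act then (1 : ℝ) else 0 := by
    intro act
    have hs : ∀ v, (t, v) ∈ (slice t : Finset (ℕ × V)) := by simp [slice]
    simp only [← active_windowAwake awake (slice t) hs]
    exact (measurable_of_finite fun η => if active (windowAwake (slice t)) t η = act then (1 : ℝ)
      else 0).comp (h.measurable_window _)
  have hind : ∀ act, IndepFun (fun ω => if active awake t ω = act then (1 : ℝ) else 0)
      (fun ω => f (update G q act (state G q awake x t ω))) μ := by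
    intro act
    have hs : ∀ v, (t, v) ∈ (slice t : Finset (ℕ × V)) := by simp [slice]
    simp only [← active_windowAwake awake (slice t) hs, state_eq_window G q awake x t]
    exact (h.indepFun_window (disjoint_past_slice t).symm).comp
      (φ := fun η => if active (windowAwake (slice t)) t η = act then (1 : ℝ) else 0)
      (ψ := fun η => f (update G q act (state G q (windowAwake (past t)) x t η)))
      (measurable_of_finite _) (measurable_of_finite _)
  have hY : ∀ act, Measurable fun ω => f (update G q act (state G q awake x t ω)) :=
    fun act => h.measurable_comp_state G q x (fun y => f (update G q act y)) t
  have hsum : (fun ω => f (state G q awake x (t + 1) ω)) = fun ω => ∑ act,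
      (if active awake t ω = act then (1 : ℝ) else 0) *
        f (update G q act (state G q awake x t ω)) := by
    ext ω
    simp [state]
  rw [hsum, integral_finsetSum]
  · refine Finset.sum_congr rfl fun act _ => ?_
    rw [(hind act).integral_fun_mul_eq_mul_integral (hX act).aestronglyMeasurable
      (hY act).aestronglyMeasurable, h.integral_indicator_active hp0]
  · intro act _
    refine (h.integrable_comp_state G q x (fun y => f (update G q act y)) t).bdd_mul
      (c := 1) (hX act).aestronglyMeasurable (Eventually.of_forall fun ω => ?_)
    split_ifs <;> simp

end Dynamics

/-! ### Second moments -/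

section Pair

variable {V : Type*} [Fintype V]

/-- The evolution of the matrix of second moments of the state in one step. -/
noncomputable def pairStep (G : Digraph V) (p q : ℝ) : Module.End ℝ (V → V → ℝ) where
  toFun M u w := ∑ act, weight p act * ((1 - q) ^ 2 * M u w +
    q * (1 - q) * (M (source G act u) w + M u (source G act w)) +
    q ^ 2 * M (source G act u) (source G act w))
  map_add' M M' := by
    ext u w
    simp only [Pi.add_apply, ← Finset.sum_add_distrib]
    exact Finset.sum_congr rfl fun _ _ => by ring
  map_smul' c M := by
    ext u w
    simp only [Pi.smul_apply, smul_eq_mul, RingHom.id_apply, Finset.mul_sum]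
    exact Finset.sum_congr rfl fun _ _ => by ring

theorem pairStep_apply (G : Digraph V) (p q : ℝ) (M : V → V → ℝ) (u w : V) :
    pairStep G p q M u w = ∑ act, weight p act * ((1 - q) ^ 2 * M u w +
      q * (1 - q) * (M (source G act u) w + M u (source G act w)) +
      q ^ 2 * M (source G act u) (source G act w)) := rfl

theorem pairStep_const (G : Digraph V) (p q c : ℝ) :
    pairStep G p q (fun _ _ => c) = fun _ _ => c := by
  ext u w
  rw [pairStep_apply, ← Finset.sum_mul, sum_weight]
  ring

variable {p q : ℝ}

theorem pairStep_mono (G : Digraph V) (hp0 : 0 ≤ p) (hp1 : p ≤ 1) (hq0 : 0 ≤ q) (hq1 : q ≤ 1) :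
    Monotone (pairStep G p q) := by
  intro M M' h u w
  rw [pairStep_apply, pairStep_apply]
  have h1 : 0 ≤ q * (1 - q) := mul_nonneg hq0 (sub_nonneg.mpr hq1)
  refine Finset.sum_le_sum fun act _ => mul_le_mul_of_nonneg_left ?_ (weight_nonneg hp0 hp1 act)
  gcongr <;> exact h _ _

theorem pairStep_pow_mono (G : Digraph V) (hp0 : 0 ≤ p) (hp1 : p ≤ 1) (hq0 : 0 ≤ q) (hq1 : q ≤ 1)
    (t : ℕ) : Monotone (pairStep G p q ^ t) := by
  rw [Module.End.coe_pow]
  exact (pairStep_mono G hp0 hp1 hq0 hq1).iterate t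

theorem pairStep_pow_const (G : Digraph V) (p q c : ℝ) (t : ℕ) :
    (pairStep G p q ^ t) (fun _ _ => c) = fun _ _ => c := by
  rw [Module.End.coe_pow]
  exact Function.iterate_fixed (pairStep_const G p q c) t

/-- If one step raises `F` by at least `M - ε`, then the second moments started at `M` have
Cesàro means at most `ε`, up to a bounded error. -/
theorem sum_pairStep_pow_le (G : Digraph V) (hp0 : 0 ≤ p) (hp1 : p ≤ 1) (hq0 : 0 ≤ q) (hq1 : q ≤ 1)
    {M F : V → V → ℝ} {ε C : ℝ} (hF0 : ∀ u w, 0 ≤ F u w) (hFC : ∀ u w, F u w ≤ C)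
    (h : ∀ u w, F u w + M u w - ε ≤ pairStep G p q F u w) (T : ℕ) (u w : V) :
    ∑ t ∈ Finset.range T, (pairStep G p q ^ t) M u w ≤ T * ε + C := by
  have step : ∀ t, (pairStep G p q ^ t) M u w ≤
      ε + ((pairStep G p q ^ (t + 1)) F u w - (pairStep G p q ^ t) F u w) := by
    intro t
    -- The monotone power `t` of the operator, which fixes the constant ε, is applied to this
    -- inequality; the sum over `t` then telescopes.
    have h1 : M ≤ pairStep G p q F - F + fun _ _ => ε := fun a b => by
      have := h a b
      simp only [Pi.add_apply, Pi.sub_apply]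
      linarith
    have h2 := pairStep_pow_mono G hp0 hp1 hq0 hq1 t h1 u w
    rw [map_add, map_sub, pairStep_pow_const] at h2
    rw [pow_succ, Module.End.mul_apply]
    simp only [Pi.add_apply, Pi.sub_apply] at h2
    linarith
  have hC : (pairStep G p q ^ T) F u w ≤ C := by
    have := pairStep_pow_mono G hp0 hp1 hq0 hq1 T (show F ≤ fun _ _ => C from hFC) u w
    rwa [pairStep_pow_const] at this
  calc _ ≤ ∑ t ∈ Finset.range T,
        (ε + ((pairStep G p q ^ (t + 1)) F u w - (pairStep G p q ^ t) F u w)) :=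
        Finset.sum_le_sum fun t _ => step t
    _ = T * ε + ((pairStep G p q ^ T) F u w - F u w) := by
        rw [Finset.sum_add_distrib, Finset.sum_range_sub fun t => (pairStep G p q ^ t) F u w]
        simp
    _ ≤ _ := by linarith [hF0 u w]

variable {Ω : Type*} [MeasurableSpace Ω] {μ : Measure Ω} [IsProbabilityMeasure μ]
  {awake : ℕ → V → Set Ω}

/-- Both factors are updated with the same `act`, so expanding their product gives exactly the three
terms of `pairStep`; the latest step is the outermost factor of the power. -/
theorem IsActivation.integral_mul_state (h : IsActivation μ p awake) (hp0 : 0 ≤ p)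
    (G : Digraph V) (q : ℝ) (x : V → ℝ) (t : ℕ) (u w : V) :
    ∫ ω, state G q awake x t ω u * state G q awake x t ω w ∂μ =
      (pairStep G p q ^ t) (fun a b => x a * x b) u w := by
  induction t generalizing u w with
  | zero => simp [state]
  | succ t ih =>
    rw [h.integral_state_succ hp0 G q x (fun y => y u * y w) t, pow_succ', Module.End.mul_apply,
      pairStep_apply]
    refine Finset.sum_congr rfl fun act _ => ?_
    have hI : ∀ a b, Integrable
        (fun ω => state G q awake x t ω a * state G q awake x t ω b) μ :=
      fun a b => h.integrable_comp_state G q x (fun y => y a * y b) t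
    have e : ∀ ω, update G q act (state G q awake x t ω) u * update G q act (state G q awake x t ω) w =
        (1 - q) ^ 2 * (state G q awake x t ω u * state G q awake x t ω w) +
        q * (1 - q) * (state G q awake x t ω (source G act u) * state G q awake x t ω w +
          state G q awake x t ω u * state G q awake x t ω (source G act w)) +
        q ^ 2 * (state G q awake x t ω (source G act u) * state G q awake x t ω (source G act w)) :=
      fun ω => by rw [update_apply, update_apply]; ring
    have hB := ((hI (source G act u) w).fun_add (hI u (source G act w))).const_mul (q * (1 - q))
    have hA := (hI u w).const_mul ((1 - q) ^ 2)
    simp only [← ih, e]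
    rw [integral_add (hA.fun_add hB) ((hI _ _).const_mul _), integral_add hA hB,
      integral_const_mul, integral_const_mul, integral_const_mul, integral_add (hI _ _) (hI _ _)]

end Pair

/-! ### Algorithms that preserve the average in expectation -/

section Average

variable {V : Type*} [Fintype V]

/-- One step of the algorithm preserves the average in expectation. -/
def PreservesAverage (G : Digraph V) (p q : ℝ) : Prop :=
  ∀ x : V → ℝ, ∑ act, weight p act * average (update G q act x) = average x

theorem sq_average (x : V → ℝ) :
    average x ^ 2 = (∑ u, ∑ w, x u * x w) / (Fintype.card V : ℝ) ^ 2 := by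
  rw [average, div_pow, sq (∑ v, x v), Finset.sum_mul_sum]

/-- Nonnegativity of the variance of the new average. -/
theorem PreservesAverage.sq_average_le {G : Digraph V} {p q : ℝ} (hG : PreservesAverage G p q)
    (hp0 : 0 ≤ p) (hp1 : p ≤ 1) (x : V → ℝ) :
    average x ^ 2 ≤ ∑ act, weight p act * average (update G q act x) ^ 2 := by
  have h : 0 ≤ ∑ act, weight p act * (average (update G q act x) - average x) ^ 2 :=
    Finset.sum_nonneg fun act _ => mul_nonneg (weight_nonneg hp0 hp1 act) (sq_nonneg _)
  have h' : ∑ act, weight p act * (average (update G q act x) - average x) ^ 2 =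
      ∑ act, weight p act * average (update G q act x) ^ 2 -
        2 * average x * ∑ act, weight p act * average (update G q act x) +
        average x ^ 2 * ∑ act : Finset V, weight p act := by
    rw [Finset.mul_sum, Finset.mul_sum, ← Finset.sum_sub_distrib, ← Finset.sum_add_distrib]
    exact Finset.sum_congr rfl fun _ _ => by ring
  rw [h', hG, sum_weight] at h
  linarith

variable {p q : ℝ} {Ω : Type*} [MeasurableSpace Ω] {μ : Measure Ω} [IsProbabilityMeasure μ]
  {awake : ℕ → V → Set Ω} {G : Digraph V}

theorem IsActivation.integral_average (h : IsActivation μ p awake) (hp0 : 0 ≤ p)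
    (hG : PreservesAverage G p q) (x : V → ℝ) (t : ℕ) :
    ∫ ω, average (state G q awake x t ω) ∂μ = average x := by
  induction t with
  | zero => simp [state]
  | succ t ih =>
    rw [h.integral_state_succ hp0 G q x average t, ← ih]
    simp only [← integral_const_mul]
    rw [← integral_finsetSum]
    · exact integral_congr_ae (Eventually.of_forall fun ω => hG _)
    · exact fun act _ =>
        (h.integrable_comp_state G q x (fun y => average (update G q act y)) t).const_mul _

theorem IsActivation.integrable_beta (h : IsActivation μ p awake) (G : Digraph V) (q : ℝ)
    (x : V → ℝ) (t : ℕ) : Integrable (beta G q awake x t) μ :=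
  h.integrable_comp_state G q x (fun y => |average y - average x| ^ 2) t

theorem IsActivation.integral_beta (h : IsActivation μ p awake) (hp0 : 0 ≤ p)
    (hG : PreservesAverage G p q) (x : V → ℝ) (t : ℕ) :
    ∫ ω, beta G q awake x t ω ∂μ =
      ∫ ω, average (state G q awake x t ω) ^ 2 ∂μ - average x ^ 2 := by
  have h1 := h.integrable_comp_state G q x (fun y => average y ^ 2) t
  have h2 := h.integrable_comp_state G q x average t
  have : beta G q awake x t = fun ω => average (state G q awake x t ω) ^ 2 -
      2 * average x * average (state G q awake x t ω) + average x ^ 2 := by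
    ext ω
    rw [beta, sq_abs]
    ring
  have h3 : Integrable (fun ω => average (state G q awake x t ω) ^ 2 -
      2 * average x * average (state G q awake x t ω)) μ := h1.sub (h2.const_mul _)
  simp only [this]
  rw [integral_add h3 (integrable_const _), integral_sub h1 (h2.const_mul _), integral_const_mul, h.integral_average hp0 hG]
  simp
  ring

theorem IsActivation.integral_sq_average (h : IsActivation μ p awake) (hp0 : 0 ≤ p)
    (x : V → ℝ) (t : ℕ) :
    ∫ ω, average (state G q awake x t ω) ^ 2 ∂μ =
      (∑ u, ∑ w, (pairStep G p q ^ t) (fun a b => x a * x b) u w) / (Fintype.card V : ℝ) ^ 2 := by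
  have hI : ∀ a b, Integrable (fun ω => state G q awake x t ω a * state G q awake x t ω b) μ :=
    fun a b => h.integrable_comp_state G q x (fun y => y a * y b) t
  simp only [sq_average]
  rw [integral_div, integral_finsetSum _ fun u _ => integrable_finsetSum _ fun w _ => hI u w]
  simp only [integral_finsetSum _ fun w _ => hI _ w, h.integral_mul_state hp0]

/-- The squared average is a submartingale, bounded because updates are convex combinations; its
expectation is monotone and bounded. -/
theorem IsActivation.exists_tendsto_integral_beta [Nonempty V] (h : IsActivation μ p awake)
    (hp0 : 0 ≤ p) (hp1 : p ≤ 1) (hq0 : 0 ≤ q) (hq1 : q ≤ 1) (hG : PreservesAverage G p q)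
    (x : V → ℝ) : ∃ l, Tendsto (fun t => ∫ ω, beta G q awake x t ω ∂μ) atTop (𝓝 l) := by
  simp only [h.integral_beta hp0 hG]
  suffices hs : ∃ l, Tendsto (fun t => ∫ ω, average (state G q awake x t ω) ^ 2 ∂μ) atTop (𝓝 l) by
    obtain ⟨l, hl⟩ := hs
    exact ⟨_, hl.sub_const _⟩
  have hI := fun t => h.integrable_comp_state G q x (fun y => average y ^ 2) t
  refine ⟨_, tendsto_atTop_ciSup (monotone_nat_of_le_succ fun t => ?_) ?_⟩
  · rw [h.integral_state_succ hp0 G q x (fun y => average y ^ 2) t]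
    simp only [← integral_const_mul]
    have hI' := fun act =>
      (h.integrable_comp_state G q x (fun y => average (update G q act y) ^ 2) t).const_mul
        (weight p act)
    rw [← integral_finsetSum _ fun act _ => hI' act]
    exact integral_mono (hI t) (integrable_finsetSum _ fun act _ => hI' act)
      fun ω => hG.sq_average_le hp0 hp1 _
  · refine ⟨(∑ v, |x v|) ^ 2, ?_⟩
    rintro _ ⟨t, rfl⟩
    have hx : ∀ u, |x u| ≤ ∑ v, |x v| := fun u =>
      Finset.single_le_sum (f := fun v => |x v|) (fun v _ => abs_nonneg _) (Finset.mem_univ u)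
    calc ∫ ω, average (state G q awake x t ω) ^ 2 ∂μ ≤ ∫ _ω, (∑ v, |x v|) ^ 2 ∂μ :=
          integral_mono (hI t) (integrable_const _) fun ω => sq_le_sq.mpr
            ((abs_average_le (abs_state_le G hq0 hq1 awake hx t ω)).trans (le_abs_self _))
      _ = _ := by simp

/-- The displacement of the average as a linear function of the initial state. -/
noncomputable def displacement (G : Digraph V) (q : ℝ) (awake : ℕ → V → Set Ω) (t : ℕ) (ω : Ω)
    (x : V → ℝ) : ℝ := average (state G q awake x t ω) - average x

omit [MeasurableSpace Ω] in
theorem displacement_eq_sum [DecidableEq V] (t : ℕ) (ω : Ω) (x : V → ℝ) :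
    displacement G q awake t ω x =
      ∑ a, x a * displacement G q awake t ω (Pi.single a 1) := by
  let avg : (V → ℝ) →ₗ[ℝ] ℝ :=
    { toFun := average
      map_add' := fun y z => by simp [average, Finset.sum_add_distrib, add_div]
      map_smul' := fun c y => by simp [average, ← Finset.mul_sum, mul_div_assoc] }
  let D : (V → ℝ) →ₗ[ℝ] ℝ := avg ∘ₗ stateMap G q awake t ω - avg
  have hD : ∀ y, D y = displacement G q awake t ω y := fun y => rfl
  simp only [← hD]
  rw [LinearMap.pi_apply_eq_sum_univ D x]
  refine Finset.sum_congr rfl fun a _ => ?_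
  rw [smul_eq_mul]
  congr 2
  ext b
  simp [Pi.single_apply, eq_comm]

/-- The displacement is linear in the initial state, so E[beta(t)] is a quadratic form. Polarization
writes its coefficients through its values at e_a, e_b and e_a + e_b, where limits exist. -/
theorem IsActivation.exists_isBiasMatrix [Nonempty V] (h : IsActivation μ p awake)
    (hp0 : 0 ≤ p) (hp1 : p ≤ 1) (hq0 : 0 ≤ q) (hq1 : q ≤ 1) (hG : PreservesAverage G p q) :
    ∃ B : Matrix V V ℝ, IsBiasMatrix μ G q awake B := by
  classical
  choose l hl using h.exists_tendsto_integral_beta hp0 hp1 hq0 hq1 hG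
  let D : V → ℕ → Ω → ℝ := fun a t ω => displacement G q awake t ω (Pi.single a 1)
  have hβ : ∀ x t ω, beta G q awake x t ω = ∑ a, ∑ b, x a * x b * (D a t ω * D b t ω) := by
    intro x t ω
    have : beta G q awake x t ω = displacement G q awake t ω x ^ 2 := sq_abs _
    rw [this, displacement_eq_sum, sq, Finset.sum_mul_sum]
    exact Finset.sum_congr rfl fun a _ => Finset.sum_congr rfl fun b _ => by simp only [D]; ring
  have hD : ∀ a b t, Integrable (fun ω => D a t ω * D b t ω) μ ∧ ∫ ω, D a t ω * D b t ω ∂μ =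
      (∫ ω, beta G q awake (Pi.single a 1 + Pi.single b 1) t ω ∂μ -
        ∫ ω, beta G q awake (Pi.single a 1) t ω ∂μ -
        ∫ ω, beta G q awake (Pi.single b 1) t ω ∂μ) / 2 := by
    intro a b t
    have hb : ∀ y ω, beta G q awake y t ω = displacement G q awake t ω y ^ 2 := fun y ω => sq_abs _
    have hI := h.integrable_beta G q
    have e : (fun ω => D a t ω * D b t ω) = fun ω =>
        (beta G q awake (Pi.single a 1 + Pi.single b 1) t ω - beta G q awake (Pi.single a 1) t ω -
          beta G q awake (Pi.single b 1) t ω) / 2 := by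
      ext ω
      have hs : displacement G q awake t ω (Pi.single a 1 + Pi.single b 1) =
          D a t ω + D b t ω := by
        rw [displacement_eq_sum]
        simp [Pi.single_apply, add_mul, Finset.sum_add_distrib, D]
      rw [hb, hb, hb, hs]
      simp only [D]
      ring
    have hI2 : Integrable (fun ω => beta G q awake (Pi.single a 1 + Pi.single b 1) t ω -
        beta G q awake (Pi.single a 1) t ω) μ := (hI _ t).sub (hI _ t)
    rw [e, integral_div, integral_sub hI2 (hI _ t),
      integral_sub (hI _ t) (hI _ t)]
    exact ⟨(((hI _ t).sub (hI _ t)).sub (hI _ t)).div_const 2, rfl⟩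
  refine ⟨fun a b => (l (Pi.single a 1 + Pi.single b 1) - l (Pi.single a 1) -
    l (Pi.single b 1)) / 2, fun x => ⟨h.integrable_beta G q x, ?_⟩⟩
  have hE : ∀ t, ∫ ω, beta G q awake x t ω ∂μ =
      ∑ a, ∑ b, x a * x b * ∫ ω, D a t ω * D b t ω ∂μ := by
    intro t
    simp only [hβ]
    have hI := fun a b => ((hD a b t).1.const_mul (x a * x b))
    rw [integral_finsetSum _ fun a _ => integrable_finsetSum _ fun b _ => hI a b]
    refine Finset.sum_congr rfl fun a _ => ?_
    rw [integral_finsetSum _ fun b _ => hI a b]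
    exact Finset.sum_congr rfl fun b _ => integral_const_mul _ _
  have hx : x ⬝ᵥ (Matrix.mulVec (fun a b => (l (Pi.single a 1 + Pi.single b 1) -
      l (Pi.single a 1) - l (Pi.single b 1)) / 2) x) = ∑ a, ∑ b, x a * x b *
        ((l (Pi.single a 1 + Pi.single b 1) - l (Pi.single a 1) - l (Pi.single b 1)) / 2) := by
    simp only [dotProduct, Matrix.mulVec, Finset.mul_sum]
    exact Finset.sum_congr rfl fun a _ => Finset.sum_congr rfl fun b _ => by ring
  rw [hx]
  simp only [hE, fun a b t => (hD a b t).2]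
  exact tendsto_finsetSum _ fun a _ => tendsto_finsetSum _ fun b _ =>
    ((((hl _).sub (hl _)).sub (hl _)).div_const 2).const_mul _

open Classical in
/-- A Lyapunov function bounds the trace of a bias matrix. -/
theorem IsBiasMatrix.trace_le [Nonempty V] (h : IsActivation μ p awake) (hp0 : 0 ≤ p)
    (hp1 : p ≤ 1) (hq0 : 0 ≤ q) (hq1 : q ≤ 1) (hG : PreservesAverage G p q) {B : Matrix V V ℝ}
    (hB : IsBiasMatrix μ G q awake B) {F : V → V → ℝ} {ε δ C : ℝ} (hδ : 0 < δ)
    (hF0 : ∀ u w, 0 ≤ F u w) (hFC : ∀ u w, F u w ≤ C)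
    (hF : ∀ u w, F u w + (if u = w then δ else 0) - ε ≤ pairStep G p q F u w) :
    B.trace ≤ ε / δ := by
  have hN : (0 : ℝ) < Fintype.card V := by exact_mod_cast Fintype.card_pos
  let J : V → V → ℝ := fun u w => if u = w then 1 else 0
  let a : ℕ → ℝ := fun t => ∑ v, ∫ ω, beta G q awake (Pi.single v 1) t ω ∂μ
  have ha : Tendsto a atTop (𝓝 B.trace) := by
    have : B.trace = ∑ v, (Pi.single v 1 : V → ℝ) ⬝ᵥ (B.mulVec (Pi.single v 1)) := by
      simp [Matrix.trace]
    rw [this]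
    exact tendsto_finsetSum _ fun v _ => (hB _).2
  have hJ : (∑ v : V, fun a b => (Pi.single v 1 : V → ℝ) a * (Pi.single v 1 : V → ℝ) b) = J := by
    ext a b
    simp only [Finset.sum_apply, J, Pi.single_apply]
    simp
  -- The subtracted squares of the initial averages are dropped; the matrices e_v e_vᵀ add up to the
  -- identity `J`.
  have ha' : ∀ t, a t ≤ (∑ u, ∑ w, (pairStep G p q ^ t) J u w) / (Fintype.card V : ℝ) ^ 2 := by
    intro t
    calc a t ≤ ∑ v, ∫ ω, average (state G q awake (Pi.single v 1) t ω) ^ 2 ∂μ := by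
          refine Finset.sum_le_sum fun v _ => ?_
          rw [h.integral_beta hp0 hG]
          linarith [sq_nonneg (average (Pi.single v (1 : ℝ)))]
      _ = _ := by
          simp only [h.integral_sq_average hp0]
          rw [← Finset.sum_div, ← hJ, map_sum, Finset.sum_comm]
          congr 1
          refine Finset.sum_congr rfl fun u _ => ?_
          rw [Finset.sum_comm]
          simp only [Finset.sum_apply]
  have hsum : ∀ T : ℕ, ∑ t ∈ Finset.range T, a t ≤ T * (ε / δ) + C / δ := by
    intro T
    have hK : ∀ u w, ∑ t ∈ Finset.range T, (pairStep G p q ^ t) J u w ≤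
        T * (ε / δ) + C / δ := by
      intro u w
      have := sum_pairStep_pow_le G hp0 hp1 hq0 hq1 hF0 hFC
        (M := δ • J) (ε := ε) (fun u w => by simpa [J] using hF u w) T u w
      simp only [map_smul, Pi.smul_apply, smul_eq_mul, ← Finset.mul_sum] at this
      rw [mul_div_assoc', ← add_div, le_div_iff₀ hδ]
      linarith
    calc _ ≤ ∑ t ∈ Finset.range T,
          (∑ u, ∑ w, (pairStep G p q ^ t) J u w) / (Fintype.card V : ℝ) ^ 2 :=
          Finset.sum_le_sum fun t _ => ha' t
      _ = (∑ u, ∑ w, ∑ t ∈ Finset.range T, (pairStep G p q ^ t) J u w) /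
            (Fintype.card V : ℝ) ^ 2 := by
          rw [← Finset.sum_div, Finset.sum_comm]
          congr 1
          exact Finset.sum_congr rfl fun u _ => Finset.sum_comm
      _ ≤ (∑ _u : V, ∑ _w : V, (T * (ε / δ) + C / δ)) / (Fintype.card V : ℝ) ^ 2 := by
          gcongr with u _ w _
          exact hK u w
      _ = _ := by
          simp only [Finset.sum_const, Finset.card_univ, nsmul_eq_mul]
          field_simp
  have hlim : Tendsto (fun T : ℕ => ε / δ + (T : ℝ)⁻¹ * (C / δ)) atTop (𝓝 (ε / δ)) := by
    simpa using (tendsto_inv_atTop_nhds_zero_nat (𝕜 := ℝ)).mul_const (C / δ) |>.const_add (ε / δ)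
  -- Convergence of `a` lets its limit be computed from Cesàro means, where the error `C / δ`
  -- disappears.
  refine le_of_tendsto_of_tendsto ha.cesaro hlim ?_
  filter_upwards [eventually_gt_atTop 0] with T hT
  have hT' : (0 : ℝ) < T := by exact_mod_cast hT
  calc (T : ℝ)⁻¹ * ∑ t ∈ Finset.range T, a t ≤ (T : ℝ)⁻¹ * (T * (ε / δ) + C / δ) := by
        gcongr; exact hsum T
    _ = _ := by field_simp

omit [IsProbabilityMeasure μ] in
theorem IsBiasMatrix.trace_nonneg {B : Matrix V V ℝ} (hB : IsBiasMatrix μ G q awake B) :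
    0 ≤ B.trace := by
  classical
  have : B.trace = ∑ v, (Pi.single v 1 : V → ℝ) ⬝ᵥ (B.mulVec (Pi.single v 1)) := by
    simp [Matrix.trace]
  rw [this]
  exact Finset.sum_nonneg fun v _ => ge_of_tendsto' (hB _).2 fun t =>
    integral_nonneg fun ω => sq_nonneg _

end Average

/-! ### Abelian Cayley graphs -/

section Cayley

variable {A : Type*} [AddCommGroup A] [Fintype A]

theorem source_cayleyDigraph_translate (S : Set A) (act : Finset A) (u : A) :
    source (cayleyDigraph S) (act.map (Equiv.addRight u).toEmbedding) u =
      source (cayleyDigraph S) act 0 + u := by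
  simpa using source_map (cayleyDigraph S) (Equiv.addRight u)
    (fun a b => by simp [cayleyDigraph]) act 0

/-- Translation by `u` preserves the law of the broadcast set and carries node `0` to `u`. -/
theorem sum_weight_source_sub (S : Set A) (p : ℝ) (f : A → ℝ) (u : A) :
    ∑ act, weight p act * f (source (cayleyDigraph S) act u - u) =
      ∑ act, weight p act * f (source (cayleyDigraph S) act 0) := by
  rw [← sum_weight_map p (Equiv.addRight u)]
  simp only [source_cayleyDigraph_translate, add_sub_cancel_right]

theorem preservesAverage_cayleyDigraph (S : Set A) (p q : ℝ) :
    PreservesAverage (cayleyDigraph S) p q := by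
  intro x
  have h1 : ∑ u, ∑ act, weight p act * x (source (cayleyDigraph S) act u) = ∑ u, x u := by
    have : ∀ u, ∑ act, weight p act * x (source (cayleyDigraph S) act u) =
        ∑ act, weight p act * x (u + source (cayleyDigraph S) act 0) := fun u => by
      simpa using sum_weight_source_sub S p (fun g => x (u + g)) u
    simp only [this]
    rw [Finset.sum_comm]
    simp only [← Finset.mul_sum]
    have : ∀ g : A, ∑ u, x (u + g) = ∑ u, x u := fun g => Equiv.sum_comp (Equiv.addRight g) x
    simp only [this, ← Finset.sum_mul, sum_weight, one_mul]
  rw [Finset.sum_comm] at h1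
  have h2 : ∀ act, weight p act * average (update (cayleyDigraph S) q act x) =
      ((1 - q) * (∑ u, x u) * weight p act +
        q * ∑ u, weight p act * x (source (cayleyDigraph S) act u)) / Fintype.card A := by
    intro act
    rw [average, mul_div_assoc']
    simp only [update_apply, Finset.sum_add_distrib, ← Finset.mul_sum]
    congr 1
    ring
  simp only [h2]
  rw [← Finset.sum_div, Finset.sum_add_distrib, ← Finset.mul_sum, ← Finset.mul_sum, sum_weight, h1,
    average]
  congr 1
  ring

end Cayley

/-! ### A Lyapunov function on the torus -/

section Parabola

/-- The concave parabola with zeros at `0` and `L`, as a function on `ℤ / L`. -/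
noncomputable def parabola (L : ℕ) (z : ZMod L) : ℝ := z.val * (L - z.val) / L

variable {L : ℕ} [NeZero L]

omit [NeZero L] in
theorem parabola_zero : parabola L 0 = 0 := by simp [parabola]

theorem parabola_nonneg (z : ZMod L) : 0 ≤ parabola L z := by
  have : (z.val : ℝ) ≤ L := by exact_mod_cast (ZMod.val_lt z).le
  exact div_nonneg (mul_nonneg (Nat.cast_nonneg _) (sub_nonneg.mpr this)) (Nat.cast_nonneg _)

theorem parabola_le (z : ZMod L) : parabola L z ≤ L := by
  have h0 : (0 : ℝ) < L := by exact_mod_cast NeZero.pos L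
  have : (z.val : ℝ) ≤ L := by exact_mod_cast (ZMod.val_lt z).le
  rw [parabola, div_le_iff₀ h0]
  have h1 : (0 : ℝ) ≤ z.val := Nat.cast_nonneg _
  nlinarith

theorem half_le_parabola {z : ZMod L} (hz : z ≠ 0) : 1 / 2 ≤ parabola L z := by
  have h0 : (0 : ℝ) < L := by exact_mod_cast NeZero.pos L
  have h1 : (1 : ℝ) ≤ z.val := by
    exact_mod_cast Nat.one_le_iff_ne_zero.mpr ((ZMod.val_ne_zero z).mpr hz)
  have h2 : (z.val : ℝ) + 1 ≤ L := by exact_mod_cast ZMod.val_lt z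
  rw [parabola, le_div_iff₀ h0]
  nlinarith

/-- The periodic extension lies above the parabola: for y = r + Lk the gap is k(2r + Lk - L), and
both factors have the same sign when k ≠ 0. Wrapping around thus never hurts a lower bound. -/
theorem le_parabola_intCast (y : ℤ) : (y * (L - y) / L : ℝ) ≤ parabola L (y : ZMod L) := by
  have h0 : (0 : ℝ) < L := by exact_mod_cast NeZero.pos L
  rw [parabola, div_le_div_iff_of_pos_right h0]
  have hL : (0 : ℤ) < L := by exact_mod_cast NeZero.pos L
  have hr : (((y : ZMod L).val : ℤ)) = y % L := ZMod.val_intCast y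
  have hy := Int.emod_add_mul_ediv y L
  have hr0 := Int.emod_nonneg y hL.ne'
  have hrL := Int.emod_lt_of_pos y hL
  set r := (y : ZMod L).val
  set k := y / (L : ℤ)
  rw [← hr] at hy hr0 hrL
  have key : 0 ≤ k * (2 * r + L * k - L) := by
    rcases lt_trichotomy k 0 with hk | hk | hk
    · refine mul_nonneg_of_nonpos_of_nonpos hk.le ?_
      nlinarith
    · simp [hk]
    · refine mul_nonneg hk.le ?_
      nlinarith
  have : y * (L - y) ≤ (r : ℤ) * (L - r) := by
    rw [← hy]
    nlinarith [mul_nonneg hL.le key]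
  exact_mod_cast this

/-- Exact second-order expansion with slope 1 - 2z/L and curvature term -h²/L; wrapping can only
increase the value. -/
theorem le_parabola_add {R : ℝ} (z : ZMod L) {h : ℤ} (hh : |(h : ℝ)| ≤ R) :
    parabola L z + h * (1 - 2 * z.val / L) - R ^ 2 / L ≤ parabola L (z + h) := by
  have h0 : (0 : ℝ) < L := by exact_mod_cast NeZero.pos L
  have hz : (z + h : ZMod L) = ((z.val + h : ℤ) : ZMod L) := by simp
  have hR : (h : ℝ) ^ 2 / L ≤ R ^ 2 / L := by
    rw [← sq_abs (h : ℝ)]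
    gcongr
  rw [hz]
  refine le_trans ?_ (le_parabola_intCast _)
  push_cast
  have : ((z.val + h) * (L - (z.val + h)) / L : ℝ) =
      parabola L z + h * (1 - 2 * z.val / L) - (h : ℝ) ^ 2 / L := by
    rw [parabola]
    field_simp
    ring
  linarith

end Parabola

/-! ### The drift of the Lyapunov function -/

section Torus

variable {d : ℕ} {S : Finset (Fin d → ℤ)} {n : ℕ}

theorem valMinAbs_intCast {m : ℤ} (h1 : -(n : ℤ) ≤ m) (h2 : m ≤ n) :
    (m : ZMod (2 * n + 1)).valMinAbs = m := by
  refine (ZMod.valMinAbs_spec _ _).mpr ⟨rfl, ?_, ?_⟩ <;> push_cast <;> linarith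

/-- The generators used lie in the cube, so their coordinates do not wrap modulo 2n+1, and the bound
is uniform in `n`. -/
theorem abs_valMinAbs_source_sub_le {i : Fin d} {R : ℕ} (hR : ∀ s ∈ S, |s i| ≤ R)
    (act : Finset (Torus d n)) (u : Torus d n) :
    |((source (torusGraph S n) act u - u) i).valMinAbs| ≤ R := by
  rcases source_eq_or_adj (torusGraph S n) act u with h | ⟨s, hs, hn, h⟩
  · simp [h]
  · have : (source (torusGraph S n) act u - u) i = ((-s i : ℤ) : ZMod (2 * n + 1)) := by
      rw [← neg_sub, h]
      simp
    rw [this, valMinAbs_intCast (by linarith [hn i]) (by linarith [hn i]), abs_neg]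
    exact hR s hs

theorem card_inNeighbors_torusGraph_le (u : Torus d n) :
    (inNeighbors (torusGraph S n) u).card ≤ S.card := by
  classical
  refine le_trans (Finset.card_le_card (t := S.image fun s => u - fun i => (s i : ZMod (2 * n + 1)))
    fun v hv => ?_) Finset.card_image_le
  obtain ⟨s, hs, -, h⟩ := (Finset.mem_filter.mp hv).2
  exact Finset.mem_image.mpr ⟨s, hs, by rw [← h]; simp⟩

/-- The Lyapunov function of the pair process on the torus: it depends only on the `i`-th coordinate
of the difference. -/
noncomputable def lyapunov (n : ℕ) (i : Fin d) (u w : Torus d n) : ℝ :=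
  parabola (2 * n + 1) ((u - w) i)

variable {p q : ℝ}

/-- The two displacements may be dependent, but the first-order term involves only their means,
which agree by translation invariance. Their difference is at most `2 * R`, whence the curvature
cost. -/
theorem lyapunov_sub_le_pairStep (hp0 : 0 ≤ p) (hp1 : p ≤ 1) (hq0 : 0 ≤ q) (hq1 : q ≤ 1)
    {i : Fin d} {R : ℕ} (hR : ∀ s ∈ S, |s i| ≤ R) (u w : Torus d n) :
    lyapunov n i u w - (2 * R) ^ 2 / ((2 * n + 1 : ℕ) : ℝ) ≤
      pairStep (torusGraph S n) p q (lyapunov n i) u w := by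
  set ε : ℝ := (2 * R) ^ 2 / ((2 * n + 1 : ℕ) : ℝ)
  have hε : 0 ≤ ε := by positivity
  let J : Finset (Torus d n) → Torus d n → ℤ := fun act u =>
    ((source (torusGraph S n) act u - u) i).valMinAbs
  have hJR : ∀ act u, |(J act u : ℝ)| ≤ R := fun act u => by
    exact_mod_cast abs_valMinAbs_source_sub_le hR act u
  have hJ : ∀ act u, source (torusGraph S n) act u i = u i + (J act u : ZMod (2 * n + 1)) :=
    fun act u => by simp [J]
  have hJmean : ∀ u, ∑ act, weight p act * (J act u : ℝ) =
      ∑ act, weight p act * (((source (torusGraph S n) act 0) i).valMinAbs : ℝ) := fun u =>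
    sum_weight_source_sub (torusGenerators S n) p (fun g => ((g i).valMinAbs : ℝ)) u
  set c : ℝ := 1 - 2 * ((u - w) i).val / ((2 * n + 1 : ℕ) : ℝ)
  -- The increments `J u`, `-J w`, `J u - J w` carry weights q(1-q), q(1-q), q², so the linear parts
  -- add up to q(J u - J w). All four weights sum to 1, so the total cost is at most ε.
  have hstep : ∀ act, lyapunov n i u w + q * c * (J act u - J act w) - ε ≤
      (1 - q) ^ 2 * lyapunov n i u w + q * (1 - q) *
        (lyapunov n i (source (torusGraph S n) act u) w +
          lyapunov n i u (source (torusGraph S n) act w)) +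
      q ^ 2 * lyapunov n i (source (torusGraph S n) act u) (source (torusGraph S n) act w) := by
    intro act
    have hu := abs_le.mp (hJR act u)
    have hw := abs_le.mp (hJR act w)
    have hR0 : (0 : ℝ) ≤ R := Nat.cast_nonneg R
    have h1 := le_parabola_add (L := 2 * n + 1) (R := 2 * R) ((u - w) i) (h := J act u)
      (abs_le.mpr ⟨by linarith, by linarith⟩)
    have h2 := le_parabola_add (L := 2 * n + 1) (R := 2 * R) ((u - w) i) (h := -J act w)
      (abs_le.mpr ⟨by push_cast; linarith, by push_cast; linarith⟩)
    have h3 := le_parabola_add (L := 2 * n + 1) (R := 2 * R) ((u - w) i) (h := J act u - J act w)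
      (abs_le.mpr ⟨by push_cast; linarith, by push_cast; linarith⟩)
    have e1 : lyapunov n i (source (torusGraph S n) act u) w =
        parabola (2 * n + 1) ((u - w) i + (J act u : ℤ)) := by
      rw [lyapunov, Pi.sub_apply, Pi.sub_apply, hJ]; congr 1; ring
    have e2 : lyapunov n i u (source (torusGraph S n) act w) =
        parabola (2 * n + 1) ((u - w) i + (-J act w : ℤ)) := by
      rw [lyapunov, Pi.sub_apply, Pi.sub_apply, hJ]; congr 1; push_cast; ring
    have e3 : lyapunov n i (source (torusGraph S n) act u) (source (torusGraph S n) act w) =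
        parabola (2 * n + 1) ((u - w) i + (J act u - J act w : ℤ)) := by
      rw [lyapunov, Pi.sub_apply, Pi.sub_apply, hJ, hJ]; congr 1; push_cast; ring
    rw [e1, e2, e3]
    have hF : lyapunov n i u w = parabola (2 * n + 1) ((u - w) i) := rfl
    rw [← hF] at h1 h2 h3
    push_cast at h1 h2 h3
    have hqq : 0 ≤ q * (1 - q) := mul_nonneg hq0 (sub_nonneg.mpr hq1)
    have H1 := mul_le_mul_of_nonneg_left h1 hqq
    have H2 := mul_le_mul_of_nonneg_left h2 hqq
    have H3 := mul_le_mul_of_nonneg_left h3 (sq_nonneg q)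
    have H4 := mul_nonneg (sq_nonneg (1 - q)) hε
    push_cast [c, ε] at H1 H2 H3 H4 ⊢
    linarith
  calc lyapunov n i u w - ε
      = ∑ act, weight p act * (lyapunov n i u w + q * c * (J act u - J act w) - ε) := by
        have : ∀ act, weight p act * (lyapunov n i u w + q * c * (J act u - J act w) - ε) =
            (lyapunov n i u w - ε) * weight p act +
              q * c * (weight p act * J act u - weight p act * J act w) := fun act => by ring
        simp only [this]
        rw [Finset.sum_add_distrib, ← Finset.mul_sum, ← Finset.mul_sum, Finset.sum_sub_distrib,
          hJmean, hJmean, sum_weight]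
        ring
    _ ≤ _ := Finset.sum_le_sum fun act _ =>
        mul_le_mul_of_nonneg_left (hstep act) (weight_nonneg hp0 hp1 act)

/-- On the diagonal only the two mixed terms survive: one walker moves, the other stays. Each is at
least 1/2 when `u` hears `u - s`, since `s i ≠ 0` separates the coordinates. -/
theorem le_pairStep_lyapunov_self (hp0 : 0 ≤ p) (hp1 : p ≤ 1) (hq0 : 0 ≤ q) (hq1 : q ≤ 1)
    {i : Fin d} {s : Fin d → ℤ} (hs : s ∈ S) (hsi : s i ≠ 0)
    (hsn : ∀ j, -(n : ℤ) ≤ s j ∧ s j ≤ n) (u : Torus d n) :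
    q * (1 - q) * (p * (1 - p) ^ S.card) ≤
      pairStep (torusGraph S n) p q (lyapunov n i) u u := by
  classical
  have hqq : 0 ≤ q * (1 - q) := mul_nonneg hq0 (sub_nonneg.mpr hq1)
  let v : Torus d n := u - fun j => (s j : ZMod (2 * n + 1))
  have huv : u i - v i ≠ 0 := by
    intro h
    have h' : (s i : ZMod (2 * n + 1)) = 0 := by simpa [v] using h
    have := valMinAbs_intCast (hsn i).1 (hsn i).2
    rw [h', ZMod.valMinAbs_zero] at this
    exact hsi this.symm
  have hadj : v ∈ inNeighbors (torusGraph S n) u :=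
    Finset.mem_filter.mpr ⟨Finset.mem_univ _, s, hs, hsn, by simp [v]⟩
  -- The nodes that must be silent for `u` to hear `v`. Inserting `u` offsets erasing `v`, so the
  -- size stays at most `S.card`, uniformly in `n`.
  let K := insert u ((inNeighbors (torusGraph S n) u).erase v)
  have hvK : v ∉ K := by
    simp only [K, Finset.mem_insert, Finset.mem_erase, ne_eq, not_true_eq_false, false_and,
      or_false]
    exact fun h => huv (by rw [h, sub_self])
  have hK : K.card ≤ S.card := by
    refine (Finset.card_insert_le _ _).trans ?_
    rw [Finset.card_erase_add_one hadj]
    exact card_inNeighbors_torusGraph_le u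
  have hsource : ∀ act, v ∈ act ∧ Disjoint K act → source (torusGraph S n) act u = v := by
    rintro act ⟨hva, hd⟩
    rw [Finset.disjoint_left] at hd
    refine source_eq_of_forall_iff (hd (Finset.mem_insert_self _ _)) fun x => ?_
    constructor
    · rintro ⟨hx, hxa⟩
      by_contra hxv
      exact hd (Finset.mem_insert_of_mem (Finset.mem_erase.mpr ⟨hxv, hx⟩)) hxa
    · rintro rfl
      exact ⟨hadj, hva⟩
  have hself : ∀ x : Torus d n, lyapunov n i x x = 0 := fun x => by
    simp [lyapunov, parabola_zero]
  calc q * (1 - q) * (p * (1 - p) ^ S.card)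
      ≤ q * (1 - q) * (p * (1 - p) ^ K.card) := by
        have : (1 - p) ^ S.card ≤ (1 - p) ^ K.card :=
          pow_le_pow_of_le_one (by linarith) (by linarith) hK
        gcongr
    _ = ∑ act, weight p act * (q * (1 - q) * (if v ∈ act ∧ Disjoint K act then 1 else 0)) := by
        rw [← sum_weight_filter p v K hvK, Finset.mul_sum]
        exact Finset.sum_congr rfl fun _ _ => (mul_left_comm _ _ _).trans (by congr)
    _ ≤ _ := by
        refine Finset.sum_le_sum fun act _ =>
          mul_le_mul_of_nonneg_left ?_ (weight_nonneg hp0 hp1 act)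
        rw [hself, hself, mul_zero, mul_zero, zero_add, add_zero]
        refine mul_le_mul_of_nonneg_left ?_ hqq
        split_ifs with h
        · rw [hsource act h]
          have h1 : 1 / 2 ≤ lyapunov n i u v := half_le_parabola huv
          have h2 : 1 / 2 ≤ lyapunov n i v u :=
            half_le_parabola (sub_ne_zero.mpr (sub_ne_zero.mp huv).symm)
          linarith
        · exact add_nonneg (parabola_nonneg _) (parabola_nonneg _)

variable {Ω : Type*} [MeasurableSpace Ω] {μ : Measure Ω} [IsProbabilityMeasure μ]
  {awake : ℕ → Torus d n → Set Ω}

theorem IsBiasMatrix.trace_torusGraph_le (h : IsActivation μ p awake) (hp0 : 0 < p) (hp1 : p < 1)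
    (hq0 : 0 < q) (hq1 : q < 1) {B : Matrix (Torus d n) (Torus d n) ℝ}
    (hB : IsBiasMatrix μ (torusGraph S n) q awake B) {i : Fin d} {R : ℕ}
    (hR : ∀ s ∈ S, |s i| ≤ R) {s : Fin d → ℤ} (hs : s ∈ S) (hsi : s i ≠ 0)
    (hsn : ∀ j, -(n : ℤ) ≤ s j ∧ s j ≤ n) :
    B.trace ≤ (2 * R) ^ 2 / ((2 * n + 1 : ℕ) : ℝ) / (q * (1 - q) * (p * (1 - p) ^ S.card)) := by
  classical
  have hp1' : 0 < 1 - p := sub_pos.mpr hp1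
  have hq1' : 0 < 1 - q := sub_pos.mpr hq1
  refine IsBiasMatrix.trace_le h hp0.le hp1.le hq0.le hq1.le
    (G := torusGraph S n)
    (preservesAverage_cayleyDigraph _ p q) hB (F := lyapunov n i) (C := (2 * n + 1 : ℕ))
    (by positivity) (fun u w => parabola_nonneg _) (fun u w => parabola_le _) fun u w => ?_
  split_ifs with huw
  · subst huw
    have h1 := le_pairStep_lyapunov_self hp0.le hp1.le hq0.le hq1.le hs hsi hsn u
    have h2 : lyapunov n i u u = 0 := by simp [lyapunov, parabola_zero]
    have h3 : (0 : ℝ) ≤ (2 * R) ^ 2 / ((2 * n + 1 : ℕ) : ℝ) := by positivity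
    linarith
  · rw [add_zero]
    exact lyapunov_sub_le_pairStep hp0.le hp1.le hq0.le hq1.le hR u w

end Torus

theorem IsBiasMatrix.trace_eq_zero_of_subsingleton {V : Type*} [Fintype V] [Subsingleton V]
    {Ω : Type*} [MeasurableSpace Ω] {μ : Measure Ω} {G : Digraph V} {q : ℝ}
    {awake : ℕ → V → Set Ω} {B : Matrix V V ℝ} (hB : IsBiasMatrix μ G q awake B) :
    B.trace = 0 := by
  classical
  have hstate : ∀ x t ω, state G q awake x t ω = x := by
    intro x t ω
    induction t with
    | zero => rfl
    | succ t ih =>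
      ext u
      rw [state, ih, update_apply, Subsingleton.elim (source G (active awake t ω) u) u]
      ring
  refine Finset.sum_eq_zero fun v _ => ?_
  have h := (hB (Pi.single v 1)).2
  simp only [beta, hstate] at h
  simpa using tendsto_nhds_unique h (by simp)

end CBGA

theorem theorem2 (d : ℕ) (S : Finset (Fin d → ℤ)) (hS0 : (0 : Fin d → ℤ) ∉ S)
    (hS : AddSubgroup.closure (S : Set (Fin d → ℤ)) = ⊤)
    (p q : ℝ) (hp0 : 0 < p) (hp1 : p < 1) (hq0 : 0 < q) (hq1 : q < 1)
    {Ω : ℕ → Type*} [∀ n, MeasurableSpace (Ω n)]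
    (μ : ∀ n, Measure (Ω n)) [∀ n, IsProbabilityMeasure (μ n)]
    (awake : ∀ n, ℕ → CBGA.Torus d n → Set (Ω n))
    (hawake : ∀ n, CBGA.IsActivation (μ n) p (awake n)) :
    (∀ n, ∃ B : Matrix (CBGA.Torus d n) (CBGA.Torus d n) ℝ,
      CBGA.IsBiasMatrix (μ n) (CBGA.torusGraph S n) q (awake n) B) ∧
    ∀ B : ∀ n, Matrix (CBGA.Torus d n) (CBGA.Torus d n) ℝ,
      (∀ n, CBGA.IsBiasMatrix (μ n) (CBGA.torusGraph S n) q (awake n) (B n)) →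
        Tendsto (fun n => (B n).trace) atTop (𝓝 0) := by
  refine ⟨fun n => (hawake n).exists_isBiasMatrix hp0.le hp1.le hq0.le hq1.le
    (CBGA.preservesAverage_cayleyDigraph _ p q), fun B hB => ?_⟩
  -- For d = 0 the torus is a point and has no coordinate on which to build F.
  rcases d with _ | d
  · simp only [fun n => (hB n).trace_eq_zero_of_subsingleton]
    exact tendsto_const_nhds
  -- Otherwise `S` would generate a subgroup of the kernel of the projection to coordinate `0`.
  obtain ⟨s, hs, hs0⟩ : ∃ s ∈ S, s 0 ≠ 0 := by
    by_contra! hcon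
    have hle : AddSubgroup.closure (S : Set (Fin (d + 1) → ℤ)) ≤
        (Pi.evalAddMonoidHom (fun _ : Fin (d + 1) => ℤ) 0).ker :=
      (AddSubgroup.closure_le _).mpr fun s hs => hcon s hs
    have h1 := hle (hS ▸ AddSubgroup.mem_top fun _ => 1)
    exact one_ne_zero h1
  let R : ℕ := S.sup fun s => (s 0).natAbs
  have hR : ∀ s ∈ S, |s 0| ≤ R := fun s hs => by
    rw [Int.abs_eq_natAbs]
    exact_mod_cast Finset.le_sup (f := fun s : Fin (d + 1) → ℤ => (s 0).natAbs) hs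
  -- From n = D on, `s` lies in the cube and survives as a generator.
  let D : ℕ := Finset.univ.sup fun j => (s j).natAbs
  refine tendsto_of_tendsto_of_tendsto_of_le_of_le' tendsto_const_nhds
    (h := fun n : ℕ => (2 * R) ^ 2 / ((2 * n + 1 : ℕ) : ℝ) / (q * (1 - q) * (p * (1 - p) ^ S.card)))
    ?_ (Eventually.of_forall fun n => (hB n).trace_nonneg) ?_
  · have h1 : Tendsto (fun n : ℕ => 2 * n + 1) atTop atTop :=
      tendsto_atTop_mono (fun n => show n ≤ 2 * n + 1 by omega) tendsto_id
    simpa using ((tendsto_natCast_atTop_atTop (R := ℝ)).comp h1).const_div_atTop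
      ((2 * R) ^ 2 : ℝ) |>.div_const (q * (1 - q) * (p * (1 - p) ^ S.card))
  · filter_upwards [eventually_ge_atTop D] with n hn
    refine (hB n).trace_torusGraph_le (hawake n) hp0 hp1 hq0 hq1 hR hs hs0 fun j => ?_
    have : (s j).natAbs ≤ n :=
      (Finset.le_sup (f := fun j => (s j).natAbs) (Finset.mem_univ j)).trans hn
    omega
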